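/- **Theorem 4.2 (Pitt's inequality for the special affine Fourier transform).** Let $A,B,C,D,p,q$ be real numbers with $B\neq 0$, and for a Schwartz function $f:\mathbb R\to\mathbb C$ define its special affine Fourier transform with these parameters by $$\widehat f_{\Lambda_S}(\omega)=\frac{1}{\sqrt{2\pi B}}\int_{\mathbb R} f(x)\,\exp\left\{\frac{i}{2B}\Big(Ax^2+2x(p-\omega)-2\omega(Dp-Bq)+D\omega^2\Big)\right\}dx,\qquad \omega\in\mathbb R,$$ where $\sqrt{\cdot}$ is the principal complex square root. Then for every Schwartz function $f$ and every real $\alpha$ with $0\le\alpha<1$, $$|B|^{\alpha}\int_{\mathbb R}|\omega|^{-\alpha}\,\big|\widehat f_{\Lambda_S}(\omega)\big|^2\,d\omega\;\le\;C_\alpha\int_{\mathbb R}|x|^{\alpha}\,|f(x)|^2\,dx,\qquad C_\alpha=\pi^{\alpha}\left[\frac{\Gamma\left(\frac{1-\alpha}{4}\right)}{\Gamma\left(\frac{1+\alpha}{4}\right)}\right]^2,$$ and all the integrals above (including the one that defines $\widehat f_{\Lambda_S}(\omega)$, for every $\omega$) converge absolutely. -/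

import Mathlib

open MeasureTheory

open scoped SchwartzMap

/-- The six real parameters of a special affine Fourier transform: the augmented
matrix `[Λ | λ]` with `Λ = [[A, B], [C, D]]` and offset vector `λ = (p, q)`. -/
structure SAFTParam where
  A : ℝ
  B : ℝ
  C : ℝ
  D : ℝ
  p : ℝ
  q : ℝ

/-- The constant `K_B = 1 / √(2πB)` (principal complex square root, as `B` may be negative). -/
noncomputable def saftConst (P : SAFTParam) : ℂ :=
  1 / Complex.sqrt ((2 * Real.pi * P.B : ℝ) : ℂ)

/-- The kernel of the special affine Fourier transform for `B ≠ 0`: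
`K_B exp {(i / 2B) (A x² + 2x(p - ω) - 2ω(Dp - Bq) + D ω²)}`. -/
noncomputable def saftKernel (P : SAFTParam) (x ω : ℝ) : ℂ :=
  saftConst P *
    Complex.exp (Complex.I / (2 * (P.B : ℂ)) *
      ((P.A * x ^ 2 + 2 * x * (P.p - ω) - 2 * ω * (P.D * P.p - P.B * P.q)
        + P.D * ω ^ 2 : ℝ) : ℂ))

open Classical in
/-- The special affine Fourier transform of `f`: an integral against the kernel if `B ≠ 0`,
a chirp multiplication (with dilation and shift) if `B = 0`. -/
noncomputable def saft (P : SAFTParam) (f : ℝ → ℂ) (ω : ℝ) : ℂ :=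
  if P.B = 0 then
    Complex.sqrt (P.D : ℂ) *
      Complex.exp (Complex.I / 2 *
        ((P.C * P.D * (ω - P.p) ^ 2 + 2 * ω * P.q : ℝ) : ℂ)) * f (P.D * (ω - P.p))
  else ∫ x : ℝ, f x * saftKernel P x ω

/-- Beckner's constant `C_α = π^α [Γ((1 - α)/4) / Γ((1 + α)/4)]²`. -/
noncomputable def pittConst (α : ℝ) : ℝ :=
  Real.pi ^ α * (Real.Gamma ((1 - α) / 4) / Real.Gamma ((1 + α) / 4)) ^ 2

/-!
# Pitt's inequality for the special affine Fourier transform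

Once the phases are factored out, the special affine Fourier transform of `f` at `ω` is, up to a unimodular
factor and the constant `(2π|B|)^(-1/2)`, the Fourier transform of a chirp times `f` at
`ω / (2πB)`; the chirp does not change `|f|` (`norm_saft`). The claim thus reduces to Pitt's
inequality `∫ |ξ|^(-α) |ĝ|² ≤ C_α ∫ |x|^α |g|²` (`pitt_inequality`). The change of variables even
gains a factor `(2π)^(-α) ≤ 1`.

For `0 < α`, `|ξ|^(-α)` is a superposition of Gaussians `exp (-π s² ξ²)` with density
`|s|^(α - 1)`. Against a single Gaussian, `∫ exp (-π s² ξ²) |ĝ|²` is at most the double integral of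
`|g(x)| |g(y)|` against the heat kernel (`lintegral_gaussian_mul_fourier_sq_le`), so after
integration in `s` the left side is bounded by a quadratic form in `|g|` whose kernel
`rieszKernel α (x - y)` is a multiple of `|x - y|^(α - 1)`. The Schur test
(`lintegral_lintegral_mul_kernel_le`) with weight `|y|^(-β)`, `β = (1 + α) / 2`, bounds that form
by `∫ |g|² |x|^α`: the Riesz potential of `|y|^(-β)` is a multiple of `|x|^(α - β)` by homogeneity
(`rieszPotential_eq`), and the multiple is found by integrating against `exp (-π x²)`, which leads
to a beta integral (`rieszPotential_one`). All the constants are Gaussian moments, and they combine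
to exactly `C_α`. For `α = 0`, where the superposition diverges, one lets `s` tend to `0` instead
(`lintegral_fourier_sq_le`).

The integrals are taken in `ℝ≥0∞`, so that Tonelli's theorem applies without integrability
hypotheses.
-/

open Real Set Filter Topology
open scoped ENNReal NNReal FourierTransform

/-! ### Gaussian moments and heat kernels -/

theorem lintegral_eq_mul_lintegral_comp_mul_left {a : ℝ} (ha : a ≠ 0) (f : ℝ → ℝ≥0∞) :
    ∫⁻ x, f x = ENNReal.ofReal |a| * ∫⁻ x, f (a * x) := by
  have h := lintegral_map_equiv (μ := volume) f (Homeomorph.mulLeft₀ a ha).toMeasurableEquiv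
  have hm : Measure.map (⇑(Homeomorph.mulLeft₀ a ha).toMeasurableEquiv) volume
      = ENNReal.ofReal |a⁻¹| • (volume : Measure ℝ) := Real.map_volume_mul_left ha
  rw [hm, lintegral_smul_measure] at h
  change _ = ∫⁻ x, f (a * x) at h
  rw [← h, smul_eq_mul, ← mul_assoc, ← ENNReal.ofReal_mul (abs_nonneg a), ← abs_mul,
    mul_inv_cancel₀ ha]
  simp

/-- The Gaussian moment `∫ |s|^(-γ) exp (-π s²) ds` for `γ < 1`, in closed form. -/
noncomputable def gaussMoment (γ : ℝ) : ℝ := π ^ ((γ - 1) / 2) * Gamma ((1 - γ) / 2)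

theorem gaussMoment_pos {γ : ℝ} (hγ : γ < 1) : 0 < gaussMoment γ :=
  mul_pos (rpow_pos_of_pos pi_pos _) (Gamma_pos_of_pos (by linarith))

theorem lintegral_abs_rpow_mul_gaussian {γ c : ℝ} (hγ : γ < 1) (hc : 0 < c) :
    ∫⁻ s : ℝ, ENNReal.ofReal (|s| ^ (-γ) * exp (-π * c * s ^ 2)) =
      ENNReal.ofReal (c ^ ((γ - 1) / 2) * gaussMoment γ) := by
  have hpi := pi_pos
  have hval : ∫ s : ℝ, |s| ^ (-γ) * exp (-π * c * s ^ 2) =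
      c ^ ((γ - 1) / 2) * gaussMoment γ := by
    have heq : ∀ s : ℝ, |s| ^ (-γ) * exp (-π * c * s ^ 2) =
        (fun x : ℝ => x ^ (-γ) * exp (-(π * c) * x ^ (2 : ℝ))) |s| := by
      intro s
      simp [neg_mul]
    simp_rw [heq]
    rw [integral_comp_abs (f := fun x : ℝ => x ^ (-γ) * exp (-(π * c) * x ^ (2 : ℝ))),
      integral_rpow_mul_exp_neg_mul_rpow two_pos (by linarith) (by positivity), gaussMoment,
      mul_rpow pi_pos.le hc.le, show -(-γ + 1) / 2 = (γ - 1) / 2 by ring,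
      show (-γ + 1) / 2 = (1 - γ) / 2 by ring]
    ring
  rw [← ofReal_integral_eq_lintegral_ofReal, hval]
  ·
    -- A function with nonzero Bochner integral is integrable.
    refine not_imp_comm.1 integral_undef ?_
    rw [hval]
    exact (mul_pos (rpow_pos_of_pos hc _) (gaussMoment_pos hγ)).ne'
  · exact ae_of_all _ fun s => by positivity

/-- The heat kernel `|s|⁻¹ exp (-π (u / s)²)`, the Fourier transform of
`ξ ↦ exp (-π s² ξ²)`. It is parametrised by the width `s` (any nonzero real) instead of the time
`s²`, so that superpositions of heat kernels are integrals over the whole line. -/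
noncomputable def heatKernel (s u : ℝ) : ℝ≥0∞ :=
  ENNReal.ofReal (|s|⁻¹ * exp (-π * (u / s) ^ 2))

theorem measurable_heatKernel : Measurable (fun p : ℝ × ℝ => heatKernel p.1 p.2) := by
  unfold heatKernel; fun_prop

theorem heatKernel_neg (s u : ℝ) : heatKernel s (-u) = heatKernel s u := by
  simp [heatKernel, neg_div]

theorem heatKernel_mul {a : ℝ} (ha : a ≠ 0) (s u : ℝ) :
    heatKernel (a * s) (a * u) = ENNReal.ofReal |a|⁻¹ * heatKernel s u := by
  rw [heatKernel, heatKernel, ← ENNReal.ofReal_mul (by positivity), mul_div_mul_left _ _ ha,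
    abs_mul, mul_inv, mul_assoc]

theorem lintegral_heatKernel_sub_mul_gaussian {s : ℝ} (hs : s ≠ 0) (y : ℝ) :
    ∫⁻ x : ℝ, heatKernel s (x - y) * ENNReal.ofReal (exp (-π * x ^ 2)) =
      ENNReal.ofReal ((1 + s ^ 2) ^ (-(1 / 2) : ℝ) * exp (-π * (1 + s ^ 2)⁻¹ * y ^ 2)) := by
  have hs2 : 0 < s ^ 2 := by positivity
  have hp : 0 < 1 + s ^ 2 := by positivity
  have hpi := pi_pos
  set b : ℝ := π * ((1 + s ^ 2) / s ^ 2) with hb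
  have hb0 : 0 < b := by positivity
  have h : ∀ x : ℝ, heatKernel s (x - y) * ENNReal.ofReal (exp (-π * x ^ 2)) =
      ENNReal.ofReal ((|s|⁻¹ * exp (-π * (1 + s ^ 2)⁻¹ * y ^ 2)) *
        exp (-b * (x - y / (1 + s ^ 2)) ^ 2)) := by
    intro x
    rw [heatKernel, ← ENNReal.ofReal_mul (by positivity), mul_assoc, mul_assoc, ← exp_add,
      ← exp_add]
    congr 3
    rw [hb]
    field_simp
    ring
  simp_rw [h]
  rw [← ofReal_integral_eq_lintegral_ofReal, integral_const_mul,
    integral_sub_right_eq_self (fun x : ℝ => exp (-b * x ^ 2)), integral_gaussian]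
  · congr 1
    have h1 : π / b = s ^ 2 / (1 + s ^ 2) := by rw [hb]; field_simp
    rw [h1, sqrt_div' _ hp.le, sqrt_sq_eq_abs, rpow_neg hp.le, ← sqrt_eq_rpow]
    have : |s| ≠ 0 := by positivity
    field_simp
  · exact ((integrable_exp_neg_mul_sq hb0).comp_sub_right _).const_mul _
  · exact ae_of_all _ fun x => by positivity

/-! ### Riesz potentials of powers -/

/-- The Riesz kernel, a constant multiple of `|u|^(α - 1)`, as a superposition of heat kernels. -/
noncomputable def rieszKernel (α u : ℝ) : ℝ≥0∞ :=
  ∫⁻ s : ℝ, ENNReal.ofReal (|s| ^ (α - 1)) * heatKernel s u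

theorem measurable_rieszKernel (α : ℝ) : Measurable (rieszKernel α) := by
  refine Measurable.lintegral_prod_right' (f := fun p : ℝ × ℝ =>
    ENNReal.ofReal (|p.2| ^ (α - 1)) * heatKernel p.2 p.1) ?_
  exact (by fun_prop : Measurable fun p : ℝ × ℝ => ENNReal.ofReal (|p.2| ^ (α - 1))).mul
    (measurable_heatKernel.comp measurable_swap)

theorem rieszKernel_neg (α u : ℝ) : rieszKernel α (-u) = rieszKernel α u := by
  simp_rw [rieszKernel, heatKernel_neg]

theorem rieszKernel_mul (α : ℝ) {a : ℝ} (ha : a ≠ 0) (u : ℝ) :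
    rieszKernel α (a * u) = ENNReal.ofReal (|a| ^ (α - 1)) * rieszKernel α u := by
  have ha' : 0 < |a| := abs_pos.2 ha
  rw [rieszKernel, lintegral_eq_mul_lintegral_comp_mul_left ha, rieszKernel,
    ← lintegral_const_mul' _ _ ENNReal.ofReal_ne_top,
    ← lintegral_const_mul' _ _ ENNReal.ofReal_ne_top]
  refine lintegral_congr fun s => ?_
  rw [heatKernel_mul ha, abs_mul, mul_rpow (abs_nonneg _) (abs_nonneg _),
    ENNReal.ofReal_mul (by positivity)]
  have : ENNReal.ofReal |a| * ENNReal.ofReal |a|⁻¹ = 1 := by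
    rw [← ENNReal.ofReal_mul ha'.le, mul_inv_cancel₀ ha'.ne', ENNReal.ofReal_one]
  calc _ = (ENNReal.ofReal |a| * ENNReal.ofReal |a|⁻¹) * (ENNReal.ofReal (|a| ^ (α - 1)) *
      (ENNReal.ofReal (|s| ^ (α - 1)) * heatKernel s u)) := by ring
    _ = _ := by rw [this, one_mul]

/-- The Riesz potential of `|y|^(-β)`, the convolution of that power with `rieszKernel α`. -/
noncomputable def rieszPotential (α β x : ℝ) : ℝ≥0∞ :=
  ∫⁻ y : ℝ, rieszKernel α (x - y) * ENNReal.ofReal (|y| ^ (-β))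

/-- By homogeneity, the Riesz potential of `|y|^(-β)` is a multiple of `|x|^(α - β)`. -/
theorem rieszPotential_eq (α β : ℝ) {x : ℝ} (hx : x ≠ 0) :
    rieszPotential α β x = ENNReal.ofReal (|x| ^ (α - β)) * rieszPotential α β 1 := by
  have hx' : 0 < |x| := abs_pos.2 hx
  rw [rieszPotential, lintegral_eq_mul_lintegral_comp_mul_left hx, rieszPotential,
    ← lintegral_const_mul' _ _ ENNReal.ofReal_ne_top,
    ← lintegral_const_mul' _ _ ENNReal.ofReal_ne_top]
  refine lintegral_congr fun y => ?_
  rw [show x - x * y = x * (1 - y) by ring, rieszKernel_mul α hx, abs_mul,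
    mul_rpow (abs_nonneg _) (abs_nonneg _), ENNReal.ofReal_mul (by positivity)]
  have : ENNReal.ofReal (|x| ^ (α - β)) = ENNReal.ofReal |x| * ENNReal.ofReal (|x| ^ (α - 1)) *
      ENNReal.ofReal (|x| ^ (-β)) := by
    rw [← ENNReal.ofReal_mul (by positivity), ← ENNReal.ofReal_mul (by positivity),
      show α - β = 1 + (α - 1) + -β by ring, rpow_add hx', rpow_add hx', rpow_one]
  rw [this]
  ring

/-- The beta integral `∫ |s|^(α - 1) (1 + s²)^(-β/2) ds`, with `(1 + s²)^(-β/2)` written as a Gaussian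
moment. -/
theorem gaussMoment_mul_lintegral {α β : ℝ} (hα : 0 < α) (hαβ : α < β) :
    ENNReal.ofReal (gaussMoment (1 - β)) *
      ∫⁻ s : ℝ, ENNReal.ofReal (|s| ^ (α - 1) * (1 + s ^ 2) ^ (-β / 2)) =
    ENNReal.ofReal (gaussMoment (1 - α) * gaussMoment (1 - β + α)) := by
  have hpi := pi_pos
  calc
    _ = ∫⁻ s : ℝ, ∫⁻ r : ℝ, ENNReal.ofReal (|s| ^ (α - 1)) *
          ENNReal.ofReal (|r| ^ (-(1 - β)) * exp (-π * (1 + s ^ 2) * r ^ 2)) := by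
      rw [← lintegral_const_mul' _ _ ENNReal.ofReal_ne_top]
      refine lintegral_congr fun s => ?_
      rw [lintegral_const_mul' _ _ ENNReal.ofReal_ne_top,
        lintegral_abs_rpow_mul_gaussian (by linarith) (by positivity),
        ← ENNReal.ofReal_mul (gaussMoment_pos (by linarith)).le,
        ← ENNReal.ofReal_mul (by positivity)]
      congr 1
      rw [show (1 - β - 1) / 2 = -β / 2 by ring]
      ring
    _ = ∫⁻ r : ℝ, ∫⁻ s : ℝ, ENNReal.ofReal (|s| ^ (α - 1)) *
          ENNReal.ofReal (|r| ^ (-(1 - β)) * exp (-π * (1 + s ^ 2) * r ^ 2)) :=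
      lintegral_lintegral_swap (by fun_prop)
    _ = ∫⁻ r : ℝ, ENNReal.ofReal (gaussMoment (1 - α)) *
          ENNReal.ofReal (|r| ^ (-(1 - β + α)) * exp (-π * 1 * r ^ 2)) := by
      refine lintegral_congr_ae ?_
      filter_upwards [Measure.ae_ne volume (0 : ℝ)] with r hr
      have hr' : 0 < |r| := abs_pos.2 hr
      have : ∀ s : ℝ, ENNReal.ofReal (|s| ^ (α - 1)) *
          ENNReal.ofReal (|r| ^ (-(1 - β)) * exp (-π * (1 + s ^ 2) * r ^ 2)) =
          ENNReal.ofReal (|r| ^ (-(1 - β)) * exp (-π * 1 * r ^ 2)) *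
            ENNReal.ofReal (|s| ^ (-(1 - α)) * exp (-π * r ^ 2 * s ^ 2)) := by
        intro s
        rw [← ENNReal.ofReal_mul (by positivity), ← ENNReal.ofReal_mul (by positivity),
          show -π * (1 + s ^ 2) * r ^ 2 = -π * 1 * r ^ 2 + -π * r ^ 2 * s ^ 2 by ring, exp_add,
          neg_sub 1 α]
        congr 1
        ring
      simp_rw [this]
      rw [lintegral_const_mul' _ _ ENNReal.ofReal_ne_top,
        lintegral_abs_rpow_mul_gaussian (by linarith) (by positivity),
        ← ENNReal.ofReal_mul (by positivity),
        ← ENNReal.ofReal_mul (gaussMoment_pos (by linarith)).le]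
      congr 1
      have : (r ^ 2) ^ ((1 - α - 1) / 2) = |r| ^ (-α) := by
        rw [← sq_abs, ← rpow_natCast, ← rpow_mul hr'.le]
        congr 1
        push_cast
        ring
      rw [this, neg_add, rpow_add hr']
      ring
    _ = _ := by
      rw [lintegral_const_mul' _ _ ENNReal.ofReal_ne_top,
        lintegral_abs_rpow_mul_gaussian (by linarith) one_pos,
        ← ENNReal.ofReal_mul (gaussMoment_pos (by linarith)).le, one_rpow, one_mul]

/-- The constant in `rieszPotential_eq`, found by integrating against a Gaussian. -/
theorem rieszPotential_one {α β : ℝ} (hα : 0 < α) (hαβ : α < β) (hβ : β < 1) :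
    ENNReal.ofReal (gaussMoment (1 - β)) * ENNReal.ofReal (gaussMoment (β - α)) *
        rieszPotential α β 1 =
      ENNReal.ofReal (gaussMoment β * (gaussMoment (1 - α) * gaussMoment (1 - β + α))) := by
  have hpi := pi_pos
  have hm := measurable_heatKernel
  have hR := measurable_rieszKernel α
  have h1 : ENNReal.ofReal (gaussMoment (β - α)) * rieszPotential α β 1 =
      ∫⁻ x : ℝ, rieszPotential α β x * ENNReal.ofReal (exp (-π * x ^ 2)) := by
    have : ENNReal.ofReal (gaussMoment (β - α)) =
        ∫⁻ x : ℝ, ENNReal.ofReal (|x| ^ (-(β - α)) * exp (-π * 1 * x ^ 2)) := by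
      rw [lintegral_abs_rpow_mul_gaussian (by linarith) one_pos, one_rpow, one_mul]
    rw [this, ← lintegral_mul_const _ (by fun_prop)]
    refine lintegral_congr_ae ?_
    filter_upwards [Measure.ae_ne volume (0 : ℝ)] with x hx
    rw [rieszPotential_eq α β hx, ENNReal.ofReal_mul (by positivity), neg_sub, mul_one]
    ring
  have h2 : ∫⁻ x : ℝ, rieszPotential α β x * ENNReal.ofReal (exp (-π * x ^ 2)) =
      ENNReal.ofReal (gaussMoment β) *
        ∫⁻ s : ℝ, ENNReal.ofReal (|s| ^ (α - 1) * (1 + s ^ 2) ^ (-β / 2)) := by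
    calc
      _ = ∫⁻ x : ℝ, ∫⁻ y : ℝ, rieszKernel α (x - y) * ENNReal.ofReal (|y| ^ (-β)) *
            ENNReal.ofReal (exp (-π * x ^ 2)) := by
        refine lintegral_congr fun x => ?_
        rw [lintegral_mul_const' _ _ ENNReal.ofReal_ne_top, rieszPotential]
      _ = ∫⁻ y : ℝ, ∫⁻ x : ℝ, rieszKernel α (x - y) * ENNReal.ofReal (|y| ^ (-β)) *
            ENNReal.ofReal (exp (-π * x ^ 2)) :=
        lintegral_lintegral_swap (by fun_prop)
      _ = ∫⁻ y : ℝ, ∫⁻ x : ℝ, ∫⁻ s : ℝ, ENNReal.ofReal (|s| ^ (α - 1)) * heatKernel s (x - y) *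
            ENNReal.ofReal (|y| ^ (-β)) * ENNReal.ofReal (exp (-π * x ^ 2)) := by
        refine lintegral_congr fun y => lintegral_congr fun x => ?_
        rw [lintegral_mul_const' _ _ ENNReal.ofReal_ne_top,
          lintegral_mul_const' _ _ ENNReal.ofReal_ne_top, rieszKernel]
      _ = ∫⁻ y : ℝ, ∫⁻ s : ℝ, ∫⁻ x : ℝ, ENNReal.ofReal (|s| ^ (α - 1)) * heatKernel s (x - y) *
            ENNReal.ofReal (|y| ^ (-β)) * ENNReal.ofReal (exp (-π * x ^ 2)) := by
        refine lintegral_congr fun y => lintegral_lintegral_swap (Measurable.aemeasurable ?_)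
        have : Measurable fun p : ℝ × ℝ => heatKernel p.2 (p.1 - y) :=
          hm.comp (by fun_prop : Measurable fun p : ℝ × ℝ => (p.2, p.1 - y))
        fun_prop
      _ = ∫⁻ y : ℝ, ∫⁻ s : ℝ, ENNReal.ofReal (|s| ^ (α - 1)) * ENNReal.ofReal (|y| ^ (-β)) *
            ENNReal.ofReal ((1 + s ^ 2) ^ (-(1 / 2) : ℝ) *
              exp (-π * (1 + s ^ 2)⁻¹ * y ^ 2)) := by
        refine lintegral_congr fun y => lintegral_congr_ae ?_
        filter_upwards [Measure.ae_ne volume (0 : ℝ)] with s hs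
        rw [← lintegral_heatKernel_sub_mul_gaussian hs, ← lintegral_const_mul' _ _ (by finiteness)]
        refine lintegral_congr fun x => by ring
      _ = ∫⁻ s : ℝ, ∫⁻ y : ℝ, ENNReal.ofReal (|s| ^ (α - 1)) * ENNReal.ofReal (|y| ^ (-β)) *
            ENNReal.ofReal ((1 + s ^ 2) ^ (-(1 / 2) : ℝ) *
              exp (-π * (1 + s ^ 2)⁻¹ * y ^ 2)) :=
        lintegral_lintegral_swap (by fun_prop)
      _ = ∫⁻ s : ℝ, ENNReal.ofReal (gaussMoment β) *
            ENNReal.ofReal (|s| ^ (α - 1) * (1 + s ^ 2) ^ (-β / 2)) := by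
        refine lintegral_congr fun s => ?_
        have hs : 0 < 1 + s ^ 2 := by positivity
        have : ∀ y : ℝ, ENNReal.ofReal (|s| ^ (α - 1)) * ENNReal.ofReal (|y| ^ (-β)) *
            ENNReal.ofReal ((1 + s ^ 2) ^ (-(1 / 2) : ℝ) * exp (-π * (1 + s ^ 2)⁻¹ * y ^ 2)) =
            ENNReal.ofReal (|s| ^ (α - 1) * (1 + s ^ 2) ^ (-(1 / 2) : ℝ)) *
              ENNReal.ofReal (|y| ^ (-β) * exp (-π * (1 + s ^ 2)⁻¹ * y ^ 2)) := by
          intro y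
          rw [← ENNReal.ofReal_mul (by positivity), ← ENNReal.ofReal_mul (by positivity),
            ← ENNReal.ofReal_mul (by positivity)]
          congr 1
          ring
        simp_rw [this]
        rw [lintegral_const_mul' _ _ ENNReal.ofReal_ne_top,
          lintegral_abs_rpow_mul_gaussian hβ (by positivity),
          ← ENNReal.ofReal_mul (by positivity), ← ENNReal.ofReal_mul (gaussMoment_pos hβ).le]
        congr 1
        have : (1 + s ^ 2) ^ (-β / 2) =
            (1 + s ^ 2) ^ (-(1 / 2) : ℝ) * (1 + s ^ 2)⁻¹ ^ ((β - 1) / 2) := by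
          rw [inv_rpow hs.le, ← rpow_neg hs.le, ← rpow_add hs]
          congr 1
          ring
        rw [this]
        ring
      _ = _ := lintegral_const_mul' _ _ ENNReal.ofReal_ne_top
  rw [mul_assoc, h1, h2, mul_left_comm, gaussMoment_mul_lintegral hα hαβ,
    ← ENNReal.ofReal_mul (gaussMoment_pos hβ).le]

/-! ### The Schur test -/

/-- **Schur test** for a symmetric convolution kernel and a positive weight `w`. -/
theorem lintegral_lintegral_mul_kernel_le {K : ℝ → ℝ≥0∞} (hK : Measurable K)
    (hKneg : ∀ x, K (-x) = K x) {u : ℝ → ℝ≥0∞} (hu : Measurable u) (hu_top : ∀ x, u x ≠ ∞)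
    {w : ℝ → ℝ} (hw : Measurable w) (hw_pos : ∀ᵐ x, 0 < w x) :
    ∫⁻ x, ∫⁻ y, u x * u y * K (x - y) ≤
      ∫⁻ x, u x ^ 2 * ENNReal.ofReal (w x)⁻¹ * ∫⁻ y, K (x - y) * ENNReal.ofReal (w y) := by
  set A : ℝ → ℝ → ℝ≥0∞ := fun x y =>
    u x ^ 2 * ENNReal.ofReal (w x)⁻¹ * (K (x - y) * ENNReal.ofReal (w y)) with hA
  have hAm : Measurable (Function.uncurry A) := by
    simp only [hA]
    fun_prop
  have hpt : ∀ {x y : ℝ}, 0 < w x → 0 < w y →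
      2 * (u x * u y * K (x - y)) ≤ A x y + A y x := by
    intro x y hx hy
    have hKs : K (y - x) = K (x - y) := by rw [← hKneg, neg_sub]
    have key : 2 * (u x * u y) ≤ u x ^ 2 * ENNReal.ofReal (w x)⁻¹ * ENNReal.ofReal (w y) +
        u y ^ 2 * ENNReal.ofReal (w y)⁻¹ * ENNReal.ofReal (w x) := by
      rw [← ENNReal.ofReal_toReal (hu_top x), ← ENNReal.ofReal_toReal (hu_top y)]
      generalize hr : (u x).toReal = a
      generalize ht : (u y).toReal = b
      have ha : 0 ≤ a := hr ▸ ENNReal.toReal_nonneg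
      have hb : 0 ≤ b := ht ▸ ENNReal.toReal_nonneg
      rw [← ENNReal.ofReal_pow ha, ← ENNReal.ofReal_pow hb, ← ENNReal.ofReal_mul ha,
        ← ENNReal.ofReal_mul (by positivity), ← ENNReal.ofReal_mul (by positivity),
        ← ENNReal.ofReal_mul (by positivity), ← ENNReal.ofReal_mul (by positivity),
        ← ENNReal.ofReal_add (by positivity) (by positivity),
        show (2 : ℝ≥0∞) = ENNReal.ofReal 2 by simp, ← ENNReal.ofReal_mul zero_le_two]
      apply ENNReal.ofReal_le_ofReal
      have : a ^ 2 * (w x)⁻¹ * w y + b ^ 2 * (w y)⁻¹ * w x - 2 * (a * b) =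
          (a * w y - b * w x) ^ 2 * (w x)⁻¹ * (w y)⁻¹ := by
        field_simp
        ring
      have : 0 ≤ (a * w y - b * w x) ^ 2 * (w x)⁻¹ * (w y)⁻¹ := by positivity
      linarith
    calc 2 * (u x * u y * K (x - y)) = 2 * (u x * u y) * K (x - y) := by ring
      _ ≤ _ := mul_le_mul_left key _
      _ = A x y + A y x := by simp only [hA, hKs]; ring
  have h2 : 2 * ∫⁻ x, ∫⁻ y, u x * u y * K (x - y) ≤ 2 * ∫⁻ x, ∫⁻ y, A x y := by
    calc
      _ = ∫⁻ x, ∫⁻ y, 2 * (u x * u y * K (x - y)) := by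
        rw [← lintegral_const_mul' _ _ ENNReal.ofNat_ne_top]
        refine lintegral_congr fun x => ?_
        rw [← lintegral_const_mul' _ _ ENNReal.ofNat_ne_top]
      _ ≤ ∫⁻ x, ∫⁻ y, (A x y + A y x) := by
        refine lintegral_mono_ae ?_
        filter_upwards [hw_pos] with x hx
        refine lintegral_mono_ae ?_
        filter_upwards [hw_pos] with y hy
        exact hpt hx hy
      _ = (∫⁻ x, ∫⁻ y, A x y) + ∫⁻ x, ∫⁻ y, A y x := by
        rw [← lintegral_add_left hAm.lintegral_prod_right]
        refine lintegral_congr fun x => ?_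
        exact lintegral_add_left (hAm.comp (by fun_prop : Measurable fun y : ℝ => (x, y))) _
      _ = _ := by
        rw [lintegral_lintegral_swap (f := fun x y => A y x) (hAm.comp measurable_swap).aemeasurable,
          two_mul]
  have h3 := (ENNReal.mul_le_mul_iff_right two_ne_zero ENNReal.ofNat_ne_top).1 h2
  refine h3.trans_eq (lintegral_congr fun x => ?_)
  rw [lintegral_const_mul _ (by fun_prop)]

/-! ### The Fourier transform against a Gaussian -/

theorem continuous_fourier {g : ℝ → ℂ} (hg : Integrable g) : Continuous (𝓕 g) :=
  VectorFourier.fourierIntegral_continuous continuous_fourierChar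
    (by exact continuous_inner) hg

theorem norm_fourier_le {g : ℝ → ℂ} (ξ : ℝ) : ‖𝓕 g ξ‖ ≤ ∫ x, ‖g x‖ :=
  VectorFourier.norm_fourierIntegral_le_integral_norm _ _ _ _ _

theorem integral_fourier_mul_eq {f g : ℝ → ℂ} (hf : Integrable f) (hg : Integrable g) :
    ∫ ξ, 𝓕 f ξ * g ξ = ∫ x, f x * 𝓕 g x := by
  simpa using! VectorFourier.integral_fourierIntegral_smul_eq_flip (L := innerₗ ℝ)
    continuous_fourierChar continuous_inner hf hg

/-- A Gaussian modulated by the character of frequency `x` has as its Fourier transform the heat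
kernel centred at `x`. -/
theorem enorm_fourier_modulated_gaussian {s : ℝ} (hs : s ≠ 0) (x y : ℝ) :
    ‖𝓕 (fun ξ : ℝ => Complex.exp (-π * (s ^ 2 : ℝ) * ξ ^ 2 + 2 * π * (Complex.I * x) * ξ)) y‖ₑ =
      heatKernel s (x - y) := by
  have hs2 : 0 < s ^ 2 := by positivity
  rw [fourier_gaussian_pi' (by rwa [Complex.ofReal_re]), ← ofReal_norm, heatKernel]
  congr 1
  rw [norm_mul, Complex.norm_exp, norm_div, norm_one, Complex.norm_cpow_eq_rpow_re_of_pos hs2]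
  have h1 : (-(π : ℂ) / ((s ^ 2 : ℝ) : ℂ) * (y + Complex.I * (Complex.I * x)) ^ 2) =
      ((-π * ((x - y) / s) ^ 2 : ℝ) : ℂ) := by
    rw [← mul_assoc, Complex.I_mul_I]
    push_cast
    field_simp
    ring
  rw [h1, Complex.ofReal_re]
  congr 1
  simp only [Complex.div_re, Complex.one_re, Complex.re_ofNat]
  norm_num
  rw [← sqrt_eq_rpow, sqrt_sq_eq_abs]

theorem integrable_gaussian_mul_of_bounded {s : ℝ} (hs : s ≠ 0) {h : ℝ → ℂ} (hh : Continuous h)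
    {C : ℝ} (hC : ∀ ξ, ‖h ξ‖ ≤ C) :
    Integrable fun ξ : ℝ => (exp (-(π * s ^ 2) * ξ ^ 2) : ℂ) * h ξ := by
  have hpi := pi_pos
  refine Integrable.mul_bdd (c := C) ?_ hh.aestronglyMeasurable (ae_of_all _ hC)
  have hb : 0 < π * s ^ 2 := by positivity
  exact (integrable_exp_neg_mul_sq hb).ofReal

/-- Gaussian regularisation of `∫ |ĝ|²`: on the other side of the Fourier transform it becomes
the heat kernel. -/
theorem lintegral_gaussian_mul_fourier_sq_le {g : ℝ → ℂ} (hg : Integrable g) {s : ℝ} (hs : s ≠ 0) :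
    ∫⁻ ξ : ℝ, ENNReal.ofReal (exp (-(π * s ^ 2) * ξ ^ 2)) * ‖𝓕 g ξ‖ₑ ^ 2 ≤
      ∫⁻ x, ∫⁻ y, ‖g x‖ₑ * ‖g y‖ₑ * heatKernel s (x - y) := by
  have hpi := pi_pos
  have hc := continuous_fourier hg
  set k : ℝ → ℂ := fun ξ => (exp (-(π * s ^ 2) * ξ ^ 2) : ℂ) * (starRingEnd ℂ) (𝓕 g ξ) with hk
  have hki : Integrable k := by
    refine integrable_gaussian_mul_of_bounded hs (by fun_prop) (C := ∫ x, ‖g x‖) fun ξ => ?_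
    rw [RCLike.norm_conj]
    exact norm_fourier_le ξ
  have hpt : ∀ ξ, 𝓕 g ξ * k ξ = ((exp (-(π * s ^ 2) * ξ ^ 2) * ‖𝓕 g ξ‖ ^ 2 : ℝ) : ℂ) := by
    intro ξ
    rw [hk, mul_left_comm, Complex.mul_conj']
    push_cast
    rfl
  have hint : Integrable fun ξ => exp (-(π * s ^ 2) * ξ ^ 2) * ‖𝓕 g ξ‖ ^ 2 := by
    have h := hki.bdd_mul hc.aestronglyMeasurable (ae_of_all _ norm_fourier_le)
    simp_rw [hpt] at h
    exact h.re
  have hLHS : ∫⁻ ξ : ℝ, ENNReal.ofReal (exp (-(π * s ^ 2) * ξ ^ 2)) * ‖𝓕 g ξ‖ₑ ^ 2 =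
      ‖∫ ξ, 𝓕 g ξ * k ξ‖ₑ := by
    simp_rw [hpt]
    rw [integral_complex_ofReal, ← ofReal_norm, Complex.norm_real,
      norm_of_nonneg (integral_nonneg fun ξ => by positivity),
      ofReal_integral_eq_lintegral_ofReal hint
        (ae_of_all _ fun ξ => by positivity)]
    refine lintegral_congr fun ξ => ?_
    rw [ENNReal.ofReal_mul (by positivity), ENNReal.ofReal_pow (norm_nonneg _),
      ofReal_norm]
  have hkhat : ∀ x, ‖𝓕 k x‖ₑ ≤ ∫⁻ y, ‖g y‖ₑ * heatKernel s (x - y) := by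
    intro x
    set m : ℝ → ℂ := fun ξ =>
      Complex.exp (-π * (s ^ 2 : ℝ) * ξ ^ 2 + 2 * π * (Complex.I * x) * ξ) with hm
    have hm_eq : ∀ ξ : ℝ, m ξ = (exp (-(π * s ^ 2) * ξ ^ 2) : ℂ) *
        Complex.exp ((2 * π * x * ξ : ℝ) * Complex.I) := by
      intro ξ
      simp only [hm]
      rw [Complex.ofReal_exp, ← Complex.exp_add]
      congr 1
      push_cast
      ring
    have hmi : Integrable m := by
      simp_rw [funext hm_eq]
      exact integrable_gaussian_mul_of_bounded hs (by fun_prop) (C := 1) fun ξ => by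
        rw [Complex.norm_exp_ofReal_mul_I]
    have hconj : 𝓕 k x = (starRingEnd ℂ) (∫ ξ, 𝓕 g ξ * m ξ) := by
      rw [← integral_conj, fourier_real_eq_integral_exp_smul]
      refine integral_congr_ae (ae_of_all _ fun ξ => ?_)
      simp only [hk, hm_eq, smul_eq_mul, map_mul, Complex.conj_ofReal, ← Complex.exp_conj,
        Complex.conj_I]
      rw [show ((-2 * π * ξ * x : ℝ) : ℂ) * Complex.I = ((2 * π * x * ξ : ℝ) : ℂ) * -Complex.I by
        push_cast; ring]
      ring
    rw [hconj, ← ofReal_norm, RCLike.norm_conj, ofReal_norm,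
      integral_fourier_mul_eq hg hmi]
    refine (enorm_integral_le_lintegral_enorm _).trans_eq (lintegral_congr fun y => ?_)
    rw [enorm_mul, enorm_fourier_modulated_gaussian hs]
  rw [hLHS, integral_fourier_mul_eq hg hki]
  refine (enorm_integral_le_lintegral_enorm _).trans (lintegral_mono fun x => ?_)
  simp_rw [mul_assoc]
  rw [enorm_mul, lintegral_const_mul' _ _ enorm_ne_top]
  exact mul_le_mul_right (hkhat x) _

theorem lintegral_heatKernel {s : ℝ} (hs : s ≠ 0) (x : ℝ) : ∫⁻ y, heatKernel s (x - y) = 1 := by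
  have hpi := pi_pos
  have h := lintegral_sub_left_eq_self (μ := volume) (heatKernel s) x
  have hs' : 0 < |s| := abs_pos.2 hs
  rw [h, lintegral_eq_mul_lintegral_comp_mul_left hs]
  have h1 := lintegral_abs_rpow_mul_gaussian zero_lt_one zero_lt_one
  have h2 : ∀ y, heatKernel s (s * y) = ENNReal.ofReal |s|⁻¹ *
      ENNReal.ofReal (|y| ^ (-0 : ℝ) * exp (-π * 1 * y ^ 2)) := by
    intro y
    rw [heatKernel, mul_div_cancel_left₀ _ hs, neg_zero, rpow_zero, one_mul, mul_one,
      ← ENNReal.ofReal_mul (by positivity)]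
  simp_rw [h2]
  rw [lintegral_const_mul' _ _ ENNReal.ofReal_ne_top, h1, gaussMoment, one_rpow, one_mul,
    ← ENNReal.ofReal_mul (by positivity), ← ENNReal.ofReal_mul (by positivity), sub_zero,
    Gamma_one_half_eq, zero_sub, sqrt_eq_rpow, ← rpow_add pi_pos]
  norm_num
  rw [← ENNReal.ofReal_mul hs'.le, mul_inv_cancel₀ hs'.ne', ENNReal.ofReal_one]

/-- The Plancherel bound `∫ |ĝ|² ≤ ∫ |g|²` for integrable `g`, with no assumption that `g` be
square integrable. -/
theorem lintegral_fourier_sq_le {g : ℝ → ℂ} (hg : Integrable g) (hgm : Measurable g) :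
    ∫⁻ ξ, ‖𝓕 g ξ‖ₑ ^ 2 ≤ ∫⁻ x, ‖g x‖ₑ ^ 2 := by
  have hc := continuous_fourier hg
  set s : ℕ → ℝ := fun n => 1 / ((n : ℝ) + 1) with hs_def
  set F : ℕ → ℝ → ℝ≥0∞ := fun n ξ =>
    ENNReal.ofReal (exp (-(π * s n ^ 2) * ξ ^ 2)) * ‖𝓕 g ξ‖ₑ ^ 2 with hF
  have hbound : ∀ n : ℕ, ∫⁻ ξ, F n ξ ≤ ∫⁻ x, ‖g x‖ₑ ^ 2 := by
    intro n
    have hs : s n ≠ 0 := Nat.one_div_pos_of_nat.ne'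
    refine (lintegral_gaussian_mul_fourier_sq_le hg hs).trans ?_
    refine (lintegral_lintegral_mul_kernel_le (K := heatKernel (s n)) (w := fun _ => 1)
      (measurable_heatKernel.comp (by fun_prop : Measurable fun x : ℝ => (s n, x)))
      (heatKernel_neg _) hgm.enorm (fun x => enorm_ne_top) measurable_const
      (ae_of_all _ fun _ => one_pos)).trans_eq ?_
    refine lintegral_congr fun x => ?_
    simp [lintegral_heatKernel hs]
  have hlim : ∀ ξ, Tendsto (fun n => F n ξ) atTop (𝓝 (‖𝓕 g ξ‖ₑ ^ 2)) := by
    intro ξ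
    have h0 : Tendsto s atTop (𝓝 0) := tendsto_one_div_add_atTop_nhds_zero_nat
    have h1 : Tendsto (fun n => exp (-(π * s n ^ 2) * ξ ^ 2)) atTop (𝓝 1) := by
      have hcont : Continuous fun r : ℝ => exp (-(π * r ^ 2) * ξ ^ 2) := by fun_prop
      simpa [Function.comp_def] using (hcont.tendsto 0).comp h0
    have h2 := ENNReal.Tendsto.mul_const (b := ‖𝓕 g ξ‖ₑ ^ 2) (ENNReal.tendsto_ofReal h1)
      (Or.inr (by finiteness))
    simpa only [one_mul, ENNReal.ofReal_one] using h2
  calc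
    _ = ∫⁻ ξ, liminf (fun n => F n ξ) atTop := lintegral_congr fun ξ => (hlim ξ).liminf_eq.symm
    _ ≤ liminf (fun n => ∫⁻ ξ, F n ξ) atTop := lintegral_liminf_le fun n => by
      have := hc.measurable
      fun_prop
    _ ≤ _ := liminf_le_of_frequently_le' (Frequently.of_forall hbound)

/-! ### Pitt's inequality for the Fourier transform -/

theorem pittConst_eq (α : ℝ) :
    pittConst α = (gaussMoment ((1 + α) / 2) / gaussMoment (1 - (1 + α) / 2)) ^ 2 := by
  rw [pittConst, gaussMoment, gaussMoment, mul_div_mul_comm, mul_pow, ← rpow_sub pi_pos,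
    ← rpow_natCast (π ^ _), ← rpow_mul pi_pos.le,
    show (1 - (1 + α) / 2) / 2 = (1 - α) / 4 by ring,
    show (1 - (1 - (1 + α) / 2)) / 2 = (1 + α) / 4 by ring]
  congr 2
  push_cast
  ring

/-- **Pitt's inequality** on the line with Beckner's constant, for the Fourier transform of
an integrable function. Either side may be infinite. -/
theorem pitt_inequality {g : ℝ → ℂ} (hg : Integrable g) (hgm : Measurable g) {α : ℝ}
    (hα0 : 0 ≤ α) (hα1 : α < 1) :
    ∫⁻ ξ, ENNReal.ofReal (|ξ| ^ (-α)) * ‖𝓕 g ξ‖ₑ ^ 2 ≤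
      ENNReal.ofReal (pittConst α) * ∫⁻ x, ENNReal.ofReal (|x| ^ α) * ‖g x‖ₑ ^ 2 := by
  rcases hα0.eq_or_lt with rfl | hα
  · have : pittConst 0 = 1 := by
      have : Gamma (1 / 4) ≠ 0 := (Gamma_pos_of_pos (by norm_num)).ne'
      rw [pittConst, sub_zero, add_zero, rpow_zero, div_self this, one_pow, one_mul]
    simpa [this] using lintegral_fourier_sq_le hg hgm
  have hpi := pi_pos
  have hc := (continuous_fourier hg).measurable
  have hm := measurable_heatKernel
  have hK := measurable_rieszKernel α
  -- The weight `|y|^(-β)` with this `β` balances the two sides of the Schur test.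
  obtain ⟨β, hβ⟩ : ∃ β : ℝ, β = (1 + α) / 2 := ⟨_, rfl⟩
  have hαβ : α < β := by linarith
  have hβ1 : β < 1 := by linarith
  have hMα := gaussMoment_pos (γ := 1 - α) (by linarith)
  have hMβ := gaussMoment_pos hβ1
  have hMβ' := gaussMoment_pos (γ := 1 - β) (by linarith)
  have hone : rieszPotential α β 1 =
      ENNReal.ofReal (gaussMoment (1 - α)) * ENNReal.ofReal (pittConst α) := by
    have h := rieszPotential_one hα hαβ hβ1
    rw [show β - α = 1 - β by linarith, show 1 - β + α = β by linarith,
      ← ENNReal.ofReal_mul hMβ'.le] at h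
    have hne : ENNReal.ofReal (gaussMoment (1 - β) * gaussMoment (1 - β)) ≠ 0 :=
      (ENNReal.ofReal_pos.2 (by positivity)).ne'
    refine (ENNReal.mul_right_inj hne ENNReal.ofReal_ne_top).1 (h.trans ?_)
    rw [← ENNReal.ofReal_mul hMα.le, ← ENNReal.ofReal_mul (by positivity), pittConst_eq α, ← hβ]
    congr 1
    field_simp
  have hMne : ENNReal.ofReal (gaussMoment (1 - α)) ≠ 0 := (ENNReal.ofReal_pos.2 hMα).ne'
  rw [← ENNReal.mul_le_mul_iff_right hMne ENNReal.ofReal_ne_top, ← mul_assoc, ← hone]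
  calc
    _ = ∫⁻ ξ, ∫⁻ s : ℝ, ENNReal.ofReal (|s| ^ (α - 1)) *
          (ENNReal.ofReal (exp (-(π * s ^ 2) * ξ ^ 2)) * ‖𝓕 g ξ‖ₑ ^ 2) := by
      rw [← lintegral_const_mul' _ _ ENNReal.ofReal_ne_top]
      refine lintegral_congr_ae ?_
      filter_upwards [Measure.ae_ne volume (0 : ℝ)] with ξ hξ
      have hξ' : 0 < |ξ| := abs_pos.2 hξ
      have : ∀ s : ℝ, ENNReal.ofReal (|s| ^ (α - 1)) *
          (ENNReal.ofReal (exp (-(π * s ^ 2) * ξ ^ 2)) * ‖𝓕 g ξ‖ₑ ^ 2) =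
          ENNReal.ofReal (|s| ^ (-(1 - α)) * exp (-π * ξ ^ 2 * s ^ 2)) * ‖𝓕 g ξ‖ₑ ^ 2 := by
        intro s
        rw [← mul_assoc, ← ENNReal.ofReal_mul (by positivity), neg_sub]
        congr 4
        ring
      simp_rw [this]
      rw [lintegral_mul_const' _ _ (by finiteness),
        lintegral_abs_rpow_mul_gaussian (by linarith) (by positivity), ← mul_assoc,
        ← ENNReal.ofReal_mul hMα.le]
      congr 2
      rw [mul_comm, ← sq_abs, ← rpow_natCast, ← rpow_mul hξ'.le]
      congr 2
      push_cast
      ring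
    _ = ∫⁻ s : ℝ, ∫⁻ ξ, ENNReal.ofReal (|s| ^ (α - 1)) *
          (ENNReal.ofReal (exp (-(π * s ^ 2) * ξ ^ 2)) * ‖𝓕 g ξ‖ₑ ^ 2) :=
      lintegral_lintegral_swap (by fun_prop)
    _ ≤ ∫⁻ s : ℝ, ∫⁻ x, ∫⁻ y, ENNReal.ofReal (|s| ^ (α - 1)) *
          (‖g x‖ₑ * ‖g y‖ₑ * heatKernel s (x - y)) := by
      refine lintegral_mono_ae ?_
      filter_upwards [Measure.ae_ne volume (0 : ℝ)] with s hs
      rw [lintegral_const_mul' _ _ ENNReal.ofReal_ne_top]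
      simp_rw [lintegral_const_mul' _ _ (ENNReal.ofReal_ne_top (r := |s| ^ (α - 1)))]
      exact mul_le_mul_right (lintegral_gaussian_mul_fourier_sq_le hg hs) _
    _ = ∫⁻ x, ∫⁻ s : ℝ, ∫⁻ y, ENNReal.ofReal (|s| ^ (α - 1)) *
          (‖g x‖ₑ * ‖g y‖ₑ * heatKernel s (x - y)) := by
      refine lintegral_lintegral_swap (Measurable.aemeasurable ?_)
      refine Measurable.lintegral_prod_right' (f := fun p : (ℝ × ℝ) × ℝ =>
        ENNReal.ofReal (|p.1.1| ^ (α - 1)) *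
          (‖g p.1.2‖ₑ * ‖g p.2‖ₑ * heatKernel p.1.1 (p.1.2 - p.2))) ?_
      have : Measurable fun p : (ℝ × ℝ) × ℝ => heatKernel p.1.1 (p.1.2 - p.2) :=
        hm.comp (by fun_prop : Measurable fun p : (ℝ × ℝ) × ℝ => (p.1.1, p.1.2 - p.2))
      fun_prop
    _ = ∫⁻ x, ∫⁻ y, ∫⁻ s : ℝ, ENNReal.ofReal (|s| ^ (α - 1)) *
          (‖g x‖ₑ * ‖g y‖ₑ * heatKernel s (x - y)) := by
      refine lintegral_congr fun x => lintegral_lintegral_swap (Measurable.aemeasurable ?_)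
      have : Measurable fun p : ℝ × ℝ => heatKernel p.1 (x - p.2) :=
        hm.comp (by fun_prop : Measurable fun p : ℝ × ℝ => (p.1, x - p.2))
      fun_prop
    _ = ∫⁻ x, ∫⁻ y, ‖g x‖ₑ * ‖g y‖ₑ * rieszKernel α (x - y) := by
      refine lintegral_congr fun x => lintegral_congr fun y => ?_
      rw [rieszKernel, ← lintegral_const_mul' _ _ (by finiteness)]
      exact lintegral_congr fun s => mul_left_comm _ _ _
    _ ≤ ∫⁻ x, ‖g x‖ₑ ^ 2 * ENNReal.ofReal (|x| ^ (-β))⁻¹ * rieszPotential α β x := by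
      refine lintegral_lintegral_mul_kernel_le hK (rieszKernel_neg α) hgm.enorm
        (fun x => enorm_ne_top) (by fun_prop) ?_
      filter_upwards [Measure.ae_ne volume (0 : ℝ)] with x hx
      exact rpow_pos_of_pos (abs_pos.2 hx) _
    _ = ∫⁻ x, rieszPotential α β 1 * (ENNReal.ofReal (|x| ^ α) * ‖g x‖ₑ ^ 2) := by
      refine lintegral_congr_ae ?_
      filter_upwards [Measure.ae_ne volume (0 : ℝ)] with x hx
      have hx' : 0 < |x| := abs_pos.2 hx
      have : |x| ^ α = (|x| ^ (-β))⁻¹ * |x| ^ (α - β) := by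
        rw [← rpow_neg hx'.le, ← rpow_add hx']
        congr 1
        ring
      rw [rieszPotential_eq α β hx, this, ENNReal.ofReal_mul (by positivity)]
      ring
    _ = _ := by
      rw [lintegral_const_mul _ (by fun_prop)]

/-! ### The special affine Fourier transform -/

/-- The product of `f` with the chirp `exp (i (A x² + 2 p x) / (2B))`. The special affine Fourier
transform of `f` is the Fourier transform of this function, up to a phase and a dilation. -/
noncomputable def chirpMul (P : SAFTParam) (f : ℝ → ℂ) (x : ℝ) : ℂ :=
  f x * Complex.exp (((P.A * x ^ 2 + 2 * x * P.p) / (2 * P.B) : ℝ) * Complex.I)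

theorem norm_chirpMul (P : SAFTParam) (f : ℝ → ℂ) (x : ℝ) : ‖chirpMul P f x‖ = ‖f x‖ := by
  rw [chirpMul, norm_mul, Complex.norm_exp_ofReal_mul_I, mul_one]

theorem continuous_chirpMul (P : SAFTParam) {f : ℝ → ℂ} (hf : Continuous f) :
    Continuous (chirpMul P f) := by
  unfold chirpMul
  fun_prop

theorem integrable_chirpMul (P : SAFTParam) {f : ℝ → ℂ} (hf : Integrable f) :
    Integrable (chirpMul P f) :=
  hf.mul_bdd (c := 1) (by fun_prop) (ae_of_all _ fun x => (Complex.norm_exp_ofReal_mul_I _).le)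

theorem mul_saftKernel (P : SAFTParam) (hB : P.B ≠ 0) (f : ℝ → ℂ) (x ω : ℝ) :
    f x * saftKernel P x ω =
      (saftConst P * Complex.exp
          (((-(2 * ω * (P.D * P.p - P.B * P.q)) + P.D * ω ^ 2) / (2 * P.B) : ℝ) * Complex.I)) *
        (Complex.exp ((-2 * π * x * ((2 * π * P.B)⁻¹ * ω) : ℝ) * Complex.I) • chirpMul P f x) := by
  have hB' : (P.B : ℂ) ≠ 0 := by exact_mod_cast hB
  have hpi : (π : ℂ) ≠ 0 := by exact_mod_cast pi_ne_zero
  have h : Complex.exp (Complex.I / (2 * (P.B : ℂ)) *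
      ((P.A * x ^ 2 + 2 * x * (P.p - ω) - 2 * ω * (P.D * P.p - P.B * P.q)
        + P.D * ω ^ 2 : ℝ) : ℂ)) =
      Complex.exp
          (((-(2 * ω * (P.D * P.p - P.B * P.q)) + P.D * ω ^ 2) / (2 * P.B) : ℝ) * Complex.I) *
        (Complex.exp ((-2 * π * x * ((2 * π * P.B)⁻¹ * ω) : ℝ) * Complex.I) *
          Complex.exp (((P.A * x ^ 2 + 2 * x * P.p) / (2 * P.B) : ℝ) * Complex.I)) := by
    rw [← Complex.exp_add, ← Complex.exp_add]
    congr 1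
    push_cast
    field_simp
    ring
  rw [saftKernel, h, chirpMul, smul_eq_mul]
  ring

theorem integrable_mul_saftKernel (P : SAFTParam) (hB : P.B ≠ 0) {f : ℝ → ℂ} (hf : Integrable f)
    (ω : ℝ) : Integrable fun x => f x * saftKernel P x ω := by
  simp_rw [mul_saftKernel P hB]
  exact ((integrable_chirpMul P hf).bdd_mul (c := 1) (by fun_prop)
    (ae_of_all _ fun x => (Complex.norm_exp_ofReal_mul_I _).le)).const_mul _

theorem norm_saftConst (P : SAFTParam) : ‖saftConst P‖ = √(2 * π * |P.B|)⁻¹ := by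
  rcases eq_or_ne P.B 0 with hB | hB
  · simp [saftConst, hB, Complex.sqrt]
  have hpi := pi_pos
  have hne : ((2 * π * P.B : ℝ) : ℂ) ≠ 0 := by
    exact_mod_cast mul_ne_zero (by positivity) hB
  have : (2⁻¹ : ℂ) = ((2⁻¹ : ℝ) : ℂ) := by push_cast; rfl
  rw [saftConst, Complex.sqrt, norm_div, norm_one, this, Complex.norm_cpow_real,
    Complex.norm_real, norm_eq_abs, abs_mul, abs_of_pos (by positivity : 0 < 2 * π), sqrt_inv,
    sqrt_eq_rpow, one_div, one_div]

theorem norm_saft (P : SAFTParam) (hB : P.B ≠ 0) (f : ℝ → ℂ) (ω : ℝ) :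
    ‖saft P f ω‖ = √(2 * π * |P.B|)⁻¹ * ‖𝓕 (chirpMul P f) ((2 * π * P.B)⁻¹ * ω)‖ := by
  simp_rw [saft, if_neg hB, mul_saftKernel P hB]
  rw [integral_const_mul, fourier_real_eq_integral_exp_smul, norm_mul, norm_mul,
    Complex.norm_exp_ofReal_mul_I, mul_one, norm_saftConst]

/-- The change of variables `ω = 2πBξ`, in which the weight contributes a factor
`(2π|B|)^(-α)`. -/
theorem lintegral_abs_rpow_mul_saft (P : SAFTParam) (hB : P.B ≠ 0) (f : ℝ → ℂ) (α : ℝ) :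
    ∫⁻ ω, ENNReal.ofReal (|ω| ^ (-α) * ‖saft P f ω‖ ^ 2) =
      ENNReal.ofReal ((2 * π * |P.B|) ^ (-α)) *
        ∫⁻ ξ, ENNReal.ofReal (|ξ| ^ (-α)) * ‖𝓕 (chirpMul P f) ξ‖ₑ ^ 2 := by
  have hpi := pi_pos
  have hB' := abs_pos.2 hB
  have hne : 2 * π * P.B ≠ 0 := mul_ne_zero (by positivity) hB
  have habs : |2 * π * P.B| = 2 * π * |P.B| := by
    rw [abs_mul, abs_of_pos (by positivity : 0 < 2 * π)]
  rw [lintegral_eq_mul_lintegral_comp_mul_left hne, habs,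
    ← lintegral_const_mul' _ _ ENNReal.ofReal_ne_top,
    ← lintegral_const_mul' _ _ ENNReal.ofReal_ne_top]
  refine lintegral_congr fun ξ => ?_
  rw [norm_saft P hB, inv_mul_cancel_left₀ hne, abs_mul, habs,
    mul_rpow (by positivity) (abs_nonneg _), mul_pow, sq_sqrt (by positivity),
    ← ofReal_norm, ← ENNReal.ofReal_pow (norm_nonneg _), ← ENNReal.ofReal_mul (by positivity),
    ← ENNReal.ofReal_mul (by positivity), ← ENNReal.ofReal_mul (by positivity)]
  congr 1
  field_simp

theorem integrable_abs_rpow_mul_sq_norm (f : 𝓢(ℝ, ℂ)) {α : ℝ} (hα0 : 0 ≤ α) (hα1 : α ≤ 1) :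
    Integrable fun x : ℝ => |x| ^ α * ‖f x‖ ^ 2 := by
  obtain ⟨C, hC0, hC⟩ := f.decay 0 0
  simp only [pow_zero, one_mul, norm_iteratedFDeriv_zero] at hC
  have h0 : Integrable fun x => ‖f x‖ := f.integrable.norm
  have h1 : Integrable fun x => |x| * ‖f x‖ := by
    simpa using f.integrable_pow_mul volume 1
  have hcont : Continuous fun x : ℝ => |x| ^ α * ‖f x‖ ^ 2 :=
    (continuous_abs.rpow_const fun _ => Or.inr hα0).mul (f.continuous.norm.pow 2)
  refine ((h0.add h1).const_mul C).mono' hcont.aestronglyMeasurable (ae_of_all _ fun x => ?_)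
  rw [norm_of_nonneg (by positivity)]
  have hx : |x| ^ α ≤ 1 + |x| := by
    rcases le_total |x| 1 with h | h
    · linarith [rpow_le_one (abs_nonneg x) h hα0, abs_nonneg x]
    · have := (rpow_le_rpow_of_exponent_le h hα1).trans_eq (rpow_one |x|)
      linarith
  calc |x| ^ α * ‖f x‖ ^ 2 ≤ (1 + |x|) * (C * ‖f x‖) := by
        rw [sq]
        gcongr
        exact hC x
    _ = C * (‖f x‖ + |x| * ‖f x‖) := by ring

theorem theorem4p2 (P : SAFTParam) (hB : P.B ≠ 0) (α : ℝ) (hα0 : 0 ≤ α) (hα1 : α < 1)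
    (f : 𝓢(ℝ, ℂ)) :
    (∀ ω : ℝ, Integrable (fun x : ℝ => f x * saftKernel P x ω)) ∧
    Integrable (fun ω : ℝ => |ω| ^ (-α) * ‖saft P f ω‖ ^ 2) ∧
    Integrable (fun x : ℝ => |x| ^ α * ‖f x‖ ^ 2) ∧
    |P.B| ^ α * ∫ ω : ℝ, |ω| ^ (-α) * ‖saft P f ω‖ ^ 2 ≤
      pittConst α * ∫ x : ℝ, |x| ^ α * ‖f x‖ ^ 2 := by
  have hpi := pi_pos
  have hB' := abs_pos.2 hB
  have hg := integrable_chirpMul P f.integrable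
  have hgc := continuous_chirpMul P f.continuous
  have hR := integrable_abs_rpow_mul_sq_norm f hα0 hα1.le
  have hconst : 0 ≤ pittConst α := by
    unfold pittConst
    positivity
  have hmeas : AEStronglyMeasurable (fun ω : ℝ => |ω| ^ (-α) * ‖saft P f ω‖ ^ 2) := by
    have := (continuous_fourier hg).measurable
    simp_rw [norm_saft P hB]
    exact Measurable.aestronglyMeasurable (by fun_prop)
  have hle : ∫⁻ ω, ENNReal.ofReal (|ω| ^ (-α) * ‖saft P f ω‖ ^ 2) ≤
      ENNReal.ofReal ((2 * π * |P.B|) ^ (-α) *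
        (pittConst α * ∫ x : ℝ, |x| ^ α * ‖f x‖ ^ 2)) := by
    rw [lintegral_abs_rpow_mul_saft P hB, ENNReal.ofReal_mul (by positivity),
      ENNReal.ofReal_mul hconst,
      ofReal_integral_eq_lintegral_ofReal hR (ae_of_all _ fun x => by positivity)]
    refine mul_le_mul_right ((pitt_inequality hg hgc.measurable hα0 hα1).trans_eq ?_) _
    congr 1
    refine lintegral_congr fun x => ?_
    rw [← ofReal_norm, norm_chirpMul, ENNReal.ofReal_mul (by positivity),
      ENNReal.ofReal_pow (norm_nonneg _)]
  have hL : Integrable fun ω : ℝ => |ω| ^ (-α) * ‖saft P f ω‖ ^ 2 := by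
    refine ⟨hmeas, ?_⟩
    rw [hasFiniteIntegral_iff_ofReal (ae_of_all _ fun ω => by positivity)]
    exact hle.trans_lt ENNReal.ofReal_lt_top
  refine ⟨integrable_mul_saftKernel P hB f.integrable, hL, hR, ?_⟩
  have hI : 0 ≤ pittConst α * ∫ x : ℝ, |x| ^ α * ‖f x‖ ^ 2 :=
    mul_nonneg hconst (integral_nonneg fun x => by positivity)
  rw [← ofReal_integral_eq_lintegral_ofReal hL (ae_of_all _ fun ω => by positivity)] at hle
  have hle' := (ENNReal.ofReal_le_ofReal_iff (by positivity)).1 hle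
  calc |P.B| ^ α * ∫ ω : ℝ, |ω| ^ (-α) * ‖saft P f ω‖ ^ 2
      ≤ |P.B| ^ α * ((2 * π * |P.B|) ^ (-α) *
          (pittConst α * ∫ x : ℝ, |x| ^ α * ‖f x‖ ^ 2)) := by gcongr
    _ = (2 * π) ^ (-α) * (pittConst α * ∫ x : ℝ, |x| ^ α * ‖f x‖ ^ 2) := by
      have : |P.B| ^ α * |P.B| ^ (-α) = 1 := by
        rw [← rpow_add hB', add_neg_cancel, rpow_zero]
      rw [mul_rpow (by positivity) hB'.le]
      linear_combination (2 * π) ^ (-α) * (pittConst α * ∫ x : ℝ, |x| ^ α * ‖f x‖ ^ 2) * this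
    _ ≤ 1 * (pittConst α * ∫ x : ℝ, |x| ^ α * ‖f x‖ ^ 2) := by
      -- In angular frequency the sharp constant is smaller by the factor `(2π)^(-α)`.
      gcongr
      exact rpow_le_one_of_one_le_of_nonpos (by linarith [pi_gt_three]) (by linarith)
    _ = _ := one_mul _
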